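/- Consider a controllable linear time-invariant system $x_{t+1}=Ax_t+Bu_t$, $y_t=Cx_t+Du_t$ with $x_t\in\mathbb R^{n_x}$, $u_t\in\mathbb R^{n_u}$, $y_t\in\mathbb R^{n_y}$ (controllable: every state can be steered to every other state in finite time). Write $w_t=(u_t,y_t)\in\mathbb R^{n_u+n_y}$, let $\mathcal W_L=(\mathbb R^{n_u+n_y})^L$, and let $\mathcal B_L\subseteq\mathcal W_L$ be the finite-horizon external behavior, i.e. the set of all $(w_0,\dots,w_{L-1})$ that satisfy the system equations for $t=0,\dots,L-1$ with some state trajectory $x_0,\dots,x_L$. Let $\mathcal M^L_{\mathcal B}=\mathcal P(\mathcal B_L)$ be the set of Borel probability measures $\mu$ on $\mathcal W_L$ with $\mu(\mathcal B_L)=1$. Let $n$ be the McMillan degree of the system (the smallest state dimension of a state-space system with the same external behavior), and let $\bar n\ge n$ be an integer (for instance $\bar n=n$). Let $w^d=(u^d,y^d)\in\mathcal B_N$ be a noise-free external trajectory of length $N$ of the system whose input component $u^d$ is persistently exciting of order $L+\bar n$, i.e. the Hankel matrix of $u^d$ with $L+\bar n$ block rows has full row rank $(L+\bar n)n_u$.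 Let $H_L(w^d)\in\mathbb R^{L(n_u+n_y)\times(N-L+1)}$ be the Hankel matrix whose $j$-th column ($j=0,\dots,N-L$) is the window $(w^d_j,\dots,w^d_{j+L-1})$. Then for every bounded measurable path cost $c:\mathcal W_L\to\mathbb R$, $$\inf_{\mu\in\mathcal M^L_{\mathcal B}}\int_{\mathcal B_L}c(w)\,d\mu(w)=\inf_{\nu\in\mathcal P(\mathbb R^{N-L+1})}\int_{\mathbb R^{N-L+1}}c\bigl(H_L(w^d)g\bigr)\,d\nu(g),$$ where $\mathcal P(\mathbb R^{N-L+1})$ denotes the Borel probability measures on $\mathbb R^{N-L+1}$. -/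

import Mathlib

open MeasureTheory Matrix

noncomputable section

/-- Length-`L` external trajectories `w = (w_0, …, w_{L-1})` with `w_t = (u_t, y_t)`: the input
`u_t` is the `Sum.inl` block and the output `y_t` the `Sum.inr` block of `w_t`. -/
abbrev ExtTraj (nu ny L : ℕ) : Type := Fin L → (Fin nu ⊕ Fin ny → ℝ)

/-- The input component `(u_0, …, u_{L-1})` of an external trajectory. -/
def ExtTraj.input {nu ny L : ℕ} (w : ExtTraj nu ny L) : Fin L → Fin nu → ℝ :=
  fun t i => w t (Sum.inl i)

/-- The output component `(y_0, …, y_{L-1})` of an external trajectory. -/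
def ExtTraj.output {nu ny L : ℕ} (w : ExtTraj nu ny L) : Fin L → Fin ny → ℝ :=
  fun t i => w t (Sum.inr i)

/-- The LTI system `x_{t+1} = A x_t + B u_t`, `y_t = C x_t + D u_t` with `x_t ∈ ℝ^nx`,
`u_t ∈ ℝ^nu`, `y_t ∈ ℝ^ny`. -/
structure LTISystem (nx nu ny : ℕ) where
  A : Matrix (Fin nx) (Fin nx) ℝ
  B : Matrix (Fin nx) (Fin nu) ℝ
  C : Matrix (Fin ny) (Fin nx) ℝ
  D : Matrix (Fin ny) (Fin nu) ℝ

namespace LTISystem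

variable {nx nu ny : ℕ}

/-- Controllability: every state can be steered to every other state in finite time. -/
def IsControllable (S : LTISystem nx nu ny) : Prop :=
  ∀ a b : Fin nx → ℝ, ∃ (K : ℕ) (x : ℕ → Fin nx → ℝ) (u : ℕ → Fin nu → ℝ),
    x 0 = a ∧ x K = b ∧ ∀ t < K, x (t + 1) = S.A *ᵥ x t + S.B *ᵥ u t

/-- The finite-horizon external behavior `𝓑_L`: all length-`L` input/output trajectories that
are compatible with the system equations for some state trajectory `x_0, …, x_L`
(free initial state). -/
def behavior (S : LTISystem nx nu ny) (L : ℕ) : Set (ExtTraj nu ny L) :=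
  {w | ∃ x : Fin (L + 1) → Fin nx → ℝ, ∀ t : Fin L,
    x t.succ = S.A *ᵥ x t.castSucc + S.B *ᵥ w.input t ∧
    w.output t = S.C *ᵥ x t.castSucc + S.D *ᵥ w.input t}

/-- The McMillan degree: the smallest state dimension of a state-space system with the same
external behavior. -/
def mcMillanDegree (S : LTISystem nx nu ny) : ℕ :=
  sInf {m : ℕ | ∃ S' : LTISystem m nu ny, ∀ K : ℕ, S'.behavior K = S.behavior K}

/-- The external behavioral-measure set `𝓟(𝓑_L)`: Borel probability measures on the trajectory
space that are supported on the behavior. -/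
def behavioralMeasures (S : LTISystem nx nu ny) (L : ℕ) :
    Set (ProbabilityMeasure (ExtTraj nu ny L)) :=
  {μ | (μ : Measure (ExtTraj nu ny L)) (S.behavior L) = 1}

end LTISystem

/-- The block Hankel matrix with `L` block rows of a length-`N` signal `z`. Its column `j`
stacks the window `z_j, …, z_{j+L-1}`. The number of columns is `N - L + 1` when `L ≤ N`
and `0` when `L > N`. -/
def hankelMatrix {ι : Type*} {N : ℕ} (L : ℕ) (z : Fin N → ι → ℝ) :
    Matrix (Fin L × ι) (Fin (N + 1 - L)) ℝ :=
  Matrix.of fun p j => z ⟨p.1 + j, by have := p.1.2; have := j.2; omega⟩ p.2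

/-- A length-`N` signal in `ℝ^m` is persistently exciting of order `k` if its Hankel matrix with
`k` block rows has full row rank `k m`. -/
def IsPersistentlyExciting {m N : ℕ} (k : ℕ) (u : Fin N → Fin m → ℝ) : Prop :=
  (hankelMatrix k u).rank = k * m

/-- The map `g ↦ H_L(w) g` from coefficient space to the space of length-`L` trajectories. -/
def hankelMap {nu ny N : ℕ} (L : ℕ) (w : ExtTraj nu ny N) (g : Fin (N + 1 - L) → ℝ) :
    ExtTraj nu ny L :=
  Function.curry (hankelMatrix L w *ᵥ g)

end

/-! By Willems' fundamental lemma (`range_hankelLinearMap`) the behavior is the range of the Hankel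
map `H`. Measures carried by that range are exactly push-forwards under `H`, since a linear section
lifts them back, so both infima run over the same set of values.

The fundamental lemma is proved by duality. A functional vanishing on all data windows acts on
trajectories as `ξ x₀ + ∑ ηᵢ uᵢ`. Rewriting its `k`-step shift from the current state slides the
sequence `…, ξAB, ξB, η₀, η₁, …` by `k`. If `p` is monic with `ξ p(A) = 0`, weighting the shifts by
the coefficients of `p` cancels the state, and persistent excitation kills the remaining input
functional. So the sequence obeys a monic recursion and is zero far to the right, hence zero
everywhere; controllability then gives `ξ = 0`. A realization of minimal dimension supplies `p` by
Cayley–Hamilton, which is why the McMillan degree suffices. -/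

noncomputable section

/-! ### Functionals along state trajectories -/

section Core

variable {X U Y : Type*} [AddCommGroup X] [Module ℝ X] [AddCommGroup U] [Module ℝ U]
  [AddCommGroup Y] [Module ℝ Y]

/-- The two-sided sequence `…, ξ A² B, ξ A B, ξ B, η₀, η₁, …` of functionals on the input space,
with `η₀` at index `0`. -/
def markovExtend (A : Module.End ℝ X) (B : U →ₗ[ℝ] X) (ξ : Module.Dual ℝ X)
    (η : ℕ → Module.Dual ℝ U) : ℤ → Module.Dual ℝ U
  | Int.ofNat i => η i
  | Int.negSucc l => ξ ∘ₗ (A ^ l) ∘ₗ B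

/-- A functional of the state and the next `L` inputs, evaluated `k` steps later, in terms of the
current state. -/
theorem functional_shift (A : Module.End ℝ X) (B : U →ₗ[ℝ] X) (ξ : Module.Dual ℝ X)
    (η : ℕ → Module.Dual ℝ U) (L : ℕ) (x : ℕ → X) (u : ℕ → U)
    (hx : ∀ t, x (t + 1) = A (x t) + B (u t)) (k j : ℕ) :
    ξ (x (j + k)) + ∑ i ∈ Finset.range L, η i (u (j + k + i)) =
      ξ ((A ^ k) (x j)) +
        ∑ i ∈ Finset.range (L + k), markovExtend A B ξ η ((i : ℤ) - k) (u (j + i)) := by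
  induction k generalizing j with
  | zero => simp [markovExtend]
  | succ k ih =>
    have h := ih (j + 1)
    rw [show j + 1 + k = j + (k + 1) by ring] at h
    rw [h, hx, map_add, map_add, ← add_assoc L k 1, Finset.sum_range_succ', pow_succ]
    have h0 : markovExtend A B ξ η (((0 : ℕ) : ℤ) - ((k + 1 : ℕ) : ℤ)) = ξ ∘ₗ (A ^ k) ∘ₗ B := by
      rw [show ((0 : ℕ) : ℤ) - ((k + 1 : ℕ) : ℤ) = Int.negSucc k by
        rw [Int.negSucc_eq]; push_cast; ring]
      rfl
    rw [h0]
    have h1 : ∀ i : ℕ, ((i + 1 : ℕ) : ℤ) - ((k + 1 : ℕ) : ℤ) = (i : ℤ) - k := by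
      intro i; push_cast; ring
    simp only [h1, LinearMap.comp_apply, Module.End.mul_apply, add_zero]
    simp only [add_assoc, add_comm 1]
    abel

/-- A finitely supported to the right sequence annihilated by a monic recursion vanishes. -/
theorem eq_zero_of_monic_recursion {E : Type*} [AddCommGroup E] [Module ℝ E] (h : ℤ → E)
    (p : Polynomial ℝ) (hp : p.Monic) (L : ℤ) (hL : ∀ i, L ≤ i → h i = 0)
    (hrec : ∀ i : ℤ, ∑ k ∈ Finset.range (p.natDegree + 1), p.coeff k • h (i - k) = 0) (i : ℤ) :
    h i = 0 := by
  have key : ∀ m : ℕ, ∀ i : ℤ, L - m ≤ i → h i = 0 := by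
    intro m
    induction m with
    | zero => intro i hi; exact hL i (by simpa using hi)
    | succ m ih =>
      intro i hi
      -- Here the leading term is `h i` itself; all other terms have larger index and already
      -- vanish.
      have h1 := hrec (i + p.natDegree)
      rw [Finset.sum_range_succ, Finset.sum_eq_zero, zero_add, hp.coeff_natDegree, one_smul,
        add_sub_cancel_right] at h1
      · exact h1
      · intro k hk
        rw [ih, smul_zero]
        have := Finset.mem_range.1 hk
        push_cast at hi
        omega
  exact key (L - i).toNat i (by omega)

/-- If a functional of the state and the next `L` inputs vanishes along a trajectory with a
persistently exciting input, then its input part and all its Markov parameters vanish. -/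
theorem markovExtend_eq_zero (A : Module.End ℝ X) (B : U →ₗ[ℝ] X) (ξ : Module.Dual ℝ X)
    (η : ℕ → Module.Dual ℝ U) (L N : ℕ) (x : ℕ → X) (u : ℕ → U)
    (hx : ∀ t, x (t + 1) = A (x t) + B (u t)) (hη : ∀ i, L ≤ i → η i = 0)
    (p : Polynomial ℝ) (hp : p.Monic) (hξ : ξ ∘ₗ Polynomial.aeval A p = 0)
    (hpe : ∀ v : ℕ → Module.Dual ℝ U,
      (∀ j, j + (L + p.natDegree) ≤ N →
        ∑ i ∈ Finset.range (L + p.natDegree), v i (u (j + i)) = 0) →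
      ∀ i < L + p.natDegree, v i = 0)
    (hf : ∀ j, j + L ≤ N → ξ (x j) + ∑ i ∈ Finset.range L, η i (u (j + i)) = 0) (i : ℤ) :
    markovExtend A B ξ η i = 0 := by
  set h := markovExtend A B ξ η with hh
  have hL : ∀ i : ℤ, (L : ℤ) ≤ i → h i = 0 := by
    intro i hi
    obtain ⟨i, rfl⟩ := Int.eq_ofNat_of_zero_le (by omega : 0 ≤ i)
    exact hη i (by omega)
  have hsum : ∀ y, ∑ k ∈ Finset.range (p.natDegree + 1), p.coeff k * ξ ((A ^ k) y) = 0 := by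
    intro y
    have := LinearMap.congr_fun hξ y
    rw [Polynomial.aeval_eq_sum_range] at this
    simpa using this
  refine eq_zero_of_monic_recursion h p hp L hL (fun i => ?_) i
  -- The recursion is `ξ p(A) Aˡ B = 0` for negative `i`, persistent excitation in the middle range,
  -- and trivial beyond the support of `η`.
  rcases lt_or_ge i 0 with hi | hi
  · ext b
    obtain ⟨l, rfl⟩ := Int.eq_negSucc_of_lt_zero hi
    have h1 : ∀ k : ℕ, h (Int.negSucc l - k) = ξ ∘ₗ (A ^ (k + l)) ∘ₗ B := by
      intro k
      rw [show Int.negSucc l - k = Int.negSucc (k + l) by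
        rw [Int.negSucc_eq, Int.negSucc_eq]; push_cast; ring]
      rfl
    simp only [h1, LinearMap.sum_apply, LinearMap.smul_apply, LinearMap.comp_apply, pow_add,
      Module.End.mul_apply, smul_eq_mul]
    exact hsum _
  rcases lt_or_ge i ((L + p.natDegree : ℕ) : ℤ) with hi' | hi'
  · obtain ⟨i, rfl⟩ := Int.eq_ofNat_of_zero_le hi
    refine hpe (fun i => ∑ k ∈ Finset.range (p.natDegree + 1), p.coeff k • h ((i : ℤ) - k))
      (fun j hj => ?_) i (by exact_mod_cast hi')
    have h2 : ∀ k ∈ Finset.range (p.natDegree + 1), p.coeff k * (ξ ((A ^ k) (x j)) +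
        ∑ i ∈ Finset.range (L + p.natDegree), h ((i : ℤ) - k) (u (j + i))) = 0 := by
      intro k hk
      have hk := Finset.mem_range.1 hk
      -- Padding by zeros puts every shift `k ≤ deg p` on one common window of length `L + deg p`.
      rw [← Finset.sum_subset (s₁ := Finset.range (L + k)), ← functional_shift A B ξ η L x u hx k j,
        hf _ (by omega), mul_zero]
      · intro a; simp only [Finset.mem_range]; omega
      · intro a _ ha
        rw [hL, LinearMap.zero_apply]
        simp only [Finset.mem_range] at ha
        omega
    have h3 := Finset.sum_eq_zero h2
    simp only [mul_add, Finset.sum_add_distrib, hsum, zero_add, Finset.mul_sum] at h3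
    rw [Finset.sum_comm] at h3
    simpa using h3
  · refine Finset.sum_eq_zero fun k hk => ?_
    have hk := Finset.mem_range.1 hk
    rw [hL, smul_zero]
    push_cast at hi'
    omega

/-- A functional of the first `L` inputs and outputs is a functional of the initial state and the
first `L` inputs; its state part is a combination of the rows of the observability matrix. -/
theorem exists_state_input_functional (A : Module.End ℝ X) (B : U →ₗ[ℝ] X) (C : X →ₗ[ℝ] Y)
    (D : U →ₗ[ℝ] Y) (p : Polynomial ℝ) (hp : C ∘ₗ Polynomial.aeval A p = 0) (L : ℕ)
    (a : ℕ → Module.Dual ℝ U) (b : ℕ → Module.Dual ℝ Y) :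
    ∃ (ξ : Module.Dual ℝ X) (η : ℕ → Module.Dual ℝ U),
      ξ ∘ₗ Polynomial.aeval A p = 0 ∧ (∀ i, L ≤ i → η i = 0) ∧
      ∀ (x : ℕ → X) (u : ℕ → U), (∀ t, x (t + 1) = A (x t) + B (u t)) →
        ∑ t ∈ Finset.range L, (a t (u t) + b t (C (x t) + D (u t))) =
          ξ (x 0) + ∑ i ∈ Finset.range L, η i (u i) := by
  induction L generalizing a b with
  | zero => exact ⟨0, 0, by simp, by simp, by simp⟩
  | succ L ih =>
    obtain ⟨ξ, η, h1, h2, h3⟩ := ih (fun t => a (t + 1)) (fun t => b (t + 1))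
    -- Substituting `x₁ = A x₀ + B u₀`: the first input acts directly, through `D`, and through
    -- `x₁`.
    refine ⟨b 0 ∘ₗ C + ξ ∘ₗ A,
      fun i => Nat.casesOn i (a 0 + b 0 ∘ₗ D + ξ ∘ₗ B) η, ?_, ?_, ?_⟩
    · have hcomm : A ∘ₗ Polynomial.aeval A p = Polynomial.aeval A p ∘ₗ A := by
        simpa [Module.End.mul_eq_comp] using
          ((Polynomial.commute_X p).map (Polynomial.aeval A)).eq
      rw [LinearMap.add_comp, LinearMap.comp_assoc, hp, LinearMap.comp_assoc, hcomm,
        ← LinearMap.comp_assoc, h1]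
      simp
    · intro i hi
      obtain ⟨i, rfl⟩ := Nat.exists_eq_add_of_le' (le_trans (by omega : 1 ≤ L + 1) hi)
      exact h2 i (by omega)
    · intro x u hx
      rw [Finset.sum_range_succ', Finset.sum_range_succ', h3 (fun t => x (t + 1))
        (fun t => u (t + 1)) (fun t => hx (t + 1)), hx]
      change _ = (b 0 ∘ₗ C + ξ ∘ₗ A) (x 0) +
        (∑ i ∈ Finset.range L, η i (u (i + 1)) + (a 0 + b 0 ∘ₗ D + ξ ∘ₗ B) (u 0))
      simp only [map_add, LinearMap.add_apply, LinearMap.comp_apply]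
      abel

end Core

/-! ### Behaviors, controllability and McMillan degree -/

namespace LTISystem

variable {nx nu ny : ℕ}

/-- Behavior membership in terms of state and input sequences indexed by all of `ℕ`. -/
theorem mem_behavior_iff (S : LTISystem nx nu ny) {L : ℕ} {w : ExtTraj nu ny L} :
    w ∈ S.behavior L ↔ ∃ (x : ℕ → Fin nx → ℝ) (u : ℕ → Fin nu → ℝ),
      (∀ t, x (t + 1) = S.A *ᵥ x t + S.B *ᵥ u t) ∧
      ∀ t : Fin L, w t = Sum.elim (u t) (S.C *ᵥ x t + S.D *ᵥ u t) := by
  constructor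
  · rintro ⟨x, hx⟩
    let u : ℕ → Fin nu → ℝ := fun t => if h : t < L then w.input ⟨t, h⟩ else 0
    let z : ℕ → Fin nx → ℝ := fun t => Nat.rec (x 0) (fun t y => S.A *ᵥ y + S.B *ᵥ u t) t
    have hu : ∀ t : Fin L, u t = w.input t := fun t => by simp [u]
    have hz : ∀ (t : ℕ) (ht : t < L + 1), z t = x ⟨t, ht⟩ := by
      intro t
      induction t with
      | zero => intro _; rfl
      | succ t ih =>
        intro ht
        have h := (hx ⟨t, by omega⟩).1
        have h' : z (t + 1) = S.A *ᵥ z t + S.B *ᵥ u t := rfl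
        rw [h', ih (by omega), hu ⟨t, by omega⟩]
        exact h.symm
    refine ⟨z, u, fun t => rfl, fun t => ?_⟩
    rw [hu t, hz t (by omega)]
    funext i
    cases i with
    | inl i => rfl
    | inr i => exact congrFun (hx t).2 i
  · rintro ⟨x, u, hx, hw⟩
    have hu : ∀ t : Fin L, w.input t = u t := fun t => by
      funext i; simp [ExtTraj.input, hw t]
    refine ⟨fun t => x t, fun t => ⟨?_, ?_⟩⟩
    · simp [hu, hx]
    · rw [hu]; funext i; simp [ExtTraj.output, hw t]

/-- The finite-horizon behavior as a linear subspace. -/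
def behaviorSubmodule (S : LTISystem nx nu ny) (L : ℕ) : Submodule ℝ (ExtTraj nu ny L) where
  carrier := S.behavior L
  zero_mem' := ⟨0, fun t => ⟨by
    have : (ExtTraj.input (0 : ExtTraj nu ny L)) t = 0 := rfl
    simp [this], by
    have : (ExtTraj.input (0 : ExtTraj nu ny L)) t = 0 := rfl
    have h : (ExtTraj.output (0 : ExtTraj nu ny L)) t = 0 := rfl
    simp [this, h]⟩⟩
  add_mem' := by
    rintro w v ⟨x, hx⟩ ⟨y, hy⟩
    refine ⟨x + y, fun t => ?_⟩
    have h1 : (w + v).input t = w.input t + v.input t := rfl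
    have h2 : (w + v).output t = w.output t + v.output t := rfl
    rw [h1, h2, (hx t).2, (hy t).2]
    simp only [Pi.add_apply, (hx t).1, (hy t).1, Matrix.mulVec_add]
    constructor <;> abel
  smul_mem' := by
    rintro r w ⟨x, hx⟩
    refine ⟨r • x, fun t => ?_⟩
    have h1 : (r • w).input t = r • w.input t := rfl
    have h2 : (r • w).output t = r • w.output t := rfl
    rw [h1, h2, (hx t).2]
    simp only [Pi.smul_apply, (hx t).1, Matrix.mulVec_smul, smul_add, and_self]

/-- A controllable system admits no nonzero functional of the state killing all `A ^ k * B`. -/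
theorem IsControllable.eq_zero_of_forall_pow {S : LTISystem nx nu ny} (hS : S.IsControllable)
    (ξ : Module.Dual ℝ (Fin nx → ℝ))
    (h : ∀ l : ℕ, ξ ∘ₗ (S.A.mulVecLin ^ l) ∘ₗ S.B.mulVecLin = 0) : ξ = 0 := by
  ext1 i
  obtain ⟨K, x, u, h0, hK, hx⟩ := hS 0 (Pi.single i 1)
  have key : ∀ t ≤ K, ∀ l : ℕ, ξ ((S.A.mulVecLin ^ l) (x t)) = 0 := by
    intro t
    induction t with
    | zero => intro _ l; simp [h0]
    | succ t ih =>
      intro ht l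
      rw [hx t (by omega), map_add, map_add]
      have h1 := ih (by omega) (l + 1)
      have h2 := LinearMap.congr_fun (h l) (u t)
      rw [pow_succ, Module.End.mul_apply] at h1
      simp only [LinearMap.comp_apply, Matrix.mulVecLin_apply, LinearMap.zero_apply] at h1 h2
      rw [h1, h2, add_zero]
  have := key K le_rfl 0
  ext
  simpa [hK] using this

/-- The zero-input response of one system is a zero-input response of any system with the same
behavior. -/
theorem exists_zero_input_response {m : ℕ} (S : LTISystem nx nu ny) (S' : LTISystem m nu ny)
    (K : ℕ) (h : S'.behavior K = S.behavior K) (a : Fin nx → ℝ) :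
    ∃ a' : Fin m → ℝ, ∀ k < K, S.C.mulVecLin ((S.A.mulVecLin ^ k) a) =
      S'.C.mulVecLin ((S'.A.mulVecLin ^ k) a') := by
  have hw : (fun t : Fin K => Sum.elim (0 : Fin nu → ℝ)
      (S.C *ᵥ (S.A.mulVecLin ^ (t : ℕ)) a + S.D *ᵥ 0)) ∈ S.behavior K :=
    S.mem_behavior_iff.2 ⟨fun t => (S.A.mulVecLin ^ t) a, fun _ => 0, fun t => by
      simp [pow_succ'], fun t => rfl⟩
  rw [← h, mem_behavior_iff] at hw
  obtain ⟨x, u, hx, hxw⟩ := hw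
  have hu : ∀ t < K, u t = 0 := fun t ht => by
    funext i; simpa using (congrFun (hxw ⟨t, ht⟩) (Sum.inl i)).symm
  have hxt : ∀ t < K, x t = (S'.A.mulVecLin ^ t) (x 0) := by
    intro t
    induction t with
    | zero => simp
    | succ t ih =>
      intro ht
      rw [hx, ih (by omega), hu t (by omega), pow_succ']
      simp
  refine ⟨x 0, fun k hk => ?_⟩
  funext i
  have := congrFun (hxw ⟨k, hk⟩) (Sum.inr i)
  simp only [Sum.elim_inr, hu k hk, hxt k hk, Matrix.mulVec_zero, add_zero] at this
  exact this

/-- Some monic polynomial in `A`, of any given degree at least the McMillan degree, is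
unobservable at the output. -/
theorem exists_monic_output_annihilator (S : LTISystem nx nu ny) (n : ℕ)
    (hn : S.mcMillanDegree ≤ n) :
    ∃ p : Polynomial ℝ, p.Monic ∧ p.natDegree = n ∧
      S.C.mulVecLin ∘ₗ Polynomial.aeval S.A.mulVecLin p = 0 := by
  obtain ⟨m, hm, S', hS'⟩ : ∃ m ≤ n, ∃ S' : LTISystem m nu ny,
      ∀ K : ℕ, S'.behavior K = S.behavior K :=
    ⟨S.mcMillanDegree, hn, Nat.sInf_mem
      (s := {m : ℕ | ∃ S' : LTISystem m nu ny, ∀ K, S'.behavior K = S.behavior K})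
      ⟨nx, S, fun _ => rfl⟩⟩
  have hq : S'.A.charpoly.Monic := S'.A.charpoly_monic
  have hqd : S'.A.charpoly.natDegree = m := by simp
  have hq0 : S.C.mulVecLin ∘ₗ Polynomial.aeval S.A.mulVecLin S'.A.charpoly = 0 := by
    refine LinearMap.ext fun a => ?_
    -- Horizon `m + 1` covers the powers `0, …, m` occurring in the characteristic polynomial.
    obtain ⟨a', ha'⟩ := exists_zero_input_response S S' (m + 1) (hS' _) a
    have hCH : Polynomial.aeval S'.A.mulVecLin S'.A.charpoly = 0 := by
      have := LinearMap.aeval_self_charpoly S'.A.mulVecLin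
      rwa [← Matrix.toLin'_apply', Matrix.charpoly_toLin'] at this
    have h := congrArg S'.C.mulVecLin (LinearMap.congr_fun hCH a')
    rw [Polynomial.aeval_eq_sum_range, hqd] at h
    rw [LinearMap.comp_apply, Polynomial.aeval_eq_sum_range, hqd]
    simp only [LinearMap.sum_apply, LinearMap.smul_apply, map_sum, map_smul,
      LinearMap.zero_apply, map_zero] at h ⊢
    rw [← h]
    exact Finset.sum_congr rfl fun k hk => by rw [ha' k (Finset.mem_range.1 hk)]
  -- The factor `X ^ (n - m)` makes the degree exactly `n`, matching the excitation order `L + n`.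
  refine ⟨S'.A.charpoly * Polynomial.X ^ (n - m), hq.mul (Polynomial.monic_X_pow _), ?_, ?_⟩
  · rw [hq.natDegree_mul (Polynomial.monic_X_pow _), hqd, Polynomial.natDegree_X_pow]
    omega
  · rw [map_mul, Module.End.mul_eq_comp, ← LinearMap.comp_assoc, hq0, LinearMap.zero_comp]

end LTISystem

/-! ### Hankel matrices and the fundamental lemma -/

/-- Persistency of excitation in terms of functionals: only the zero functional vanishes on all
windows of length `k`. -/
theorem IsPersistentlyExciting.eq_zero_of_forall_window {m N k : ℕ} {u : Fin N → Fin m → ℝ}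
    (hu : IsPersistentlyExciting k u) (z : ℕ → Fin m → ℝ) (hz : ∀ t : Fin N, z t = u t)
    (v : ℕ → Module.Dual ℝ (Fin m → ℝ))
    (hv : ∀ j, j + k ≤ N → ∑ i ∈ Finset.range k, v i (z (j + i)) = 0) :
    ∀ i < k, v i = 0 := by
  have hli : LinearIndependent ℝ (hankelMatrix k u).row := by
    rw [linearIndependent_iff_card_eq_finrank_span, Set.finrank,
      ← Matrix.rank_eq_finrank_span_row]
    simpa using hu.symm
  rw [Fintype.linearIndependent_iff] at hli
  have h := hli (fun q => v q.1 (Pi.single q.2 1)) (by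
    funext j
    have h1 := hv j (by omega)
    rw [Finset.sum_range] at h1
    rw [Pi.zero_apply, ← h1, Fintype.sum_prod_type, Finset.sum_apply]
    refine Finset.sum_congr rfl fun i _ => ?_
    have h2 : z (j + i) = u ⟨i + j, by omega⟩ := by
      rw [← hz]; simp [add_comm]
    rw [h2, LinearMap.pi_apply_eq_sum_univ (v i), Finset.sum_apply]
    refine Finset.sum_congr rfl fun q _ => ?_
    simp only [Pi.smul_apply, smul_eq_mul, Matrix.row, hankelMatrix, Matrix.of_apply]
    rw [mul_comm]
    congr 2
    funext r
    simp [Pi.single_apply, eq_comm])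
  intro i hi
  ext q
  simpa using h (⟨i, hi⟩, q)

/-- `hankelMap` as a linear map. -/
def hankelLinearMap {nu ny N : ℕ} (L : ℕ) (w : ExtTraj nu ny N) :
    (Fin (N + 1 - L) → ℝ) →ₗ[ℝ] ExtTraj nu ny L where
  toFun := hankelMap L w
  map_add' g h := by
    funext t i; simp [hankelMap, Function.curry, Matrix.mulVec_add]
  map_smul' r g := by
    funext t i; simp [hankelMap, Function.curry, Matrix.mulVec_smul]

theorem hankelLinearMap_single {nu ny N : ℕ} (L : ℕ) (w : ExtTraj nu ny N)
    (j : Fin (N + 1 - L)) :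
    hankelLinearMap L w (Pi.single j 1) = fun t : Fin L => w ⟨t + j, by omega⟩ := by
  funext t i
  simp [hankelLinearMap, hankelMap, Function.curry, hankelMatrix]

/-- Time invariance puts each Hankel column in the behavior, which is a linear subspace. -/
theorem range_hankelLinearMap_le {nx nu ny : ℕ} (S : LTISystem nx nu ny) {L N : ℕ}
    {wd : ExtTraj nu ny N} (hwd : wd ∈ S.behavior N) :
    LinearMap.range (hankelLinearMap L wd) ≤ S.behaviorSubmodule L := by
  rintro _ ⟨g, rfl⟩
  rw [LinearMap.pi_apply_eq_sum_univ]
  refine Submodule.sum_mem _ fun j _ => Submodule.smul_mem _ _ ?_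
  have : (fun k => if j = k then (1 : ℝ) else 0) = Pi.single j 1 := by
    funext r; simp [Pi.single_apply, eq_comm]
  rw [this, hankelLinearMap_single]
  obtain ⟨x, u, hx, hw⟩ := S.mem_behavior_iff.1 hwd
  refine S.mem_behavior_iff.2 ⟨fun t => x (t + j), fun t => u (t + j), fun t => ?_, fun t => hw _⟩
  rw [← hx, add_right_comm]

/-- A functional on external trajectories splits into functionals of the inputs and outputs. -/
theorem exists_input_output_functionals {nu ny L : ℕ} (φ : Module.Dual ℝ (ExtTraj nu ny L)) :
    ∃ (a : ℕ → Module.Dual ℝ (Fin nu → ℝ)) (b : ℕ → Module.Dual ℝ (Fin ny → ℝ)),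
      ∀ (u : ℕ → Fin nu → ℝ) (y : ℕ → Fin ny → ℝ),
        φ (fun t => Sum.elim (u t) (y t)) = ∑ t ∈ Finset.range L, (a t (u t) + b t (y t)) := by
  let e := LinearEquiv.sumArrowLequivProdArrow (Fin nu) (Fin ny) ℝ ℝ
  let ψ : Fin L → (Fin nu → ℝ) × (Fin ny → ℝ) →ₗ[ℝ] ℝ := fun t =>
    φ ∘ₗ LinearMap.single ℝ (fun _ : Fin L => (Fin nu ⊕ Fin ny → ℝ)) t ∘ₗ e.symm.toLinearMap
  refine ⟨fun t => if h : t < L then ψ ⟨t, h⟩ ∘ₗ LinearMap.inl ℝ _ _ else 0,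
    fun t => if h : t < L then ψ ⟨t, h⟩ ∘ₗ LinearMap.inr ℝ _ _ else 0, fun u y => ?_⟩
  rw [Finset.sum_range]
  have h1 : (fun t : Fin L => Sum.elim (u t) (y t)) =
      ∑ t, LinearMap.single ℝ (fun _ : Fin L => (Fin nu ⊕ Fin ny → ℝ)) t
        (e.symm (u t, y t)) := by
    rw [← LinearMap.sum_single_apply _ (fun t : Fin L => Sum.elim (u t) (y t))]
    rfl
  rw [h1, map_sum]
  refine Finset.sum_congr rfl fun t _ => ?_
  simp only [Fin.is_lt, dite_true, LinearMap.comp_apply, LinearMap.inl_apply,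
    LinearMap.inr_apply, ← map_add, Prod.mk_add_mk, add_zero, zero_add, Fin.eta, ψ]
  rfl

/-- **Willems' fundamental lemma** for controllable systems: windows of a trajectory with
sufficiently persistently exciting input span the finite-horizon behavior. -/
theorem range_hankelLinearMap {nx nu ny : ℕ} (S : LTISystem nx nu ny) (hS : S.IsControllable)
    {L N : ℕ} {wd : ExtTraj nu ny N} (hwd : wd ∈ S.behavior N) {n : ℕ}
    (hn : S.mcMillanDegree ≤ n) (hpe : IsPersistentlyExciting (L + n) wd.input) :
    LinearMap.range (hankelLinearMap L wd) = S.behaviorSubmodule L := by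
  refine le_antisymm (range_hankelLinearMap_le S hwd) fun w hw => ?_
  by_contra hwr
  obtain ⟨φ, hφw, hφ⟩ := Submodule.exists_le_ker_of_notMem hwr
  refine hφw ?_
  obtain ⟨p, hp, hpn, hCp⟩ := S.exists_monic_output_annihilator n hn
  obtain ⟨a, b, hab⟩ := exists_input_output_functionals φ
  obtain ⟨ξ, η, hξ, hη, hfun⟩ := exists_state_input_functional S.A.mulVecLin S.B.mulVecLin
    S.C.mulVecLin S.D.mulVecLin p hCp L a b
  have hval : ∀ (x : ℕ → Fin nx → ℝ) (u : ℕ → Fin nu → ℝ),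
      (∀ t, x (t + 1) = S.A *ᵥ x t + S.B *ᵥ u t) →
      φ (fun t => Sum.elim (u t) (S.C *ᵥ x t + S.D *ᵥ u t)) =
        ξ (x 0) + ∑ i ∈ Finset.range L, η i (u i) := fun x u hx =>
    (hab u fun t => S.C *ᵥ x t + S.D *ᵥ u t).trans (hfun x u hx)
  obtain ⟨x, u, hx, hxw⟩ := S.mem_behavior_iff.1 hwd
  have hzero := markovExtend_eq_zero S.A.mulVecLin S.B.mulVecLin ξ η L N x u hx hη p hp hξ
    (fun v hv => by
      rw [hpn] at hv ⊢
      refine hpe.eq_zero_of_forall_window u (fun t => ?_) v hv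
      funext i; simp [ExtTraj.input, hxw t])
    -- The data window starting at `j` is a Hankel column, so `φ` kills it.
    (fun j hj => by
      have h1 := hval (fun t => x (j + t)) (fun t => u (j + t)) (fun t => hx _)
      rw [add_zero] at h1
      rw [← h1]
      have h2 : hankelLinearMap L wd (Pi.single ⟨j, by omega⟩ 1) ∈ LinearMap.ker φ :=
        hφ (LinearMap.mem_range_self _ _)
      rw [hankelLinearMap_single, LinearMap.mem_ker] at h2
      rw [← h2]
      congr 1
      funext t
      rw [hxw]
      simp [add_comm])
  have hξ0 : ξ = 0 := hS.eq_zero_of_forall_pow ξ fun l => hzero (Int.negSucc l)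
  have hη0 : ∀ i, η i = 0 := fun i => hzero (Int.ofNat i)
  obtain ⟨x', u', hx', hw'⟩ := S.mem_behavior_iff.1 hw
  have := hval x' u' hx'
  rw [← funext hw'] at this
  simpa [hξ0, hη0] using this

/-! ### Transport of measures -/

/-- Averages of `c` over probability measures on the range of a linear map are averages of its
pull-back along that map. -/
theorem range_integral_range_eq {E F : Type*} [NormedAddCommGroup E] [NormedSpace ℝ E]
    [FiniteDimensional ℝ E] [MeasurableSpace E] [BorelSpace E] [NormedAddCommGroup F]
    [NormedSpace ℝ F] [FiniteDimensional ℝ F] [MeasurableSpace F] [BorelSpace F]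
    (H : E →ₗ[ℝ] F) (c : F → ℝ) (hc : Measurable c) :
    Set.range (fun μ : {μ : ProbabilityMeasure F | (μ : Measure F) (LinearMap.range H) = 1} =>
        ∫ w in (LinearMap.range H : Set F), c w ∂((μ : ProbabilityMeasure F) : Measure F)) =
      Set.range (fun ν : ProbabilityMeasure E => ∫ g, c (H g) ∂(ν : Measure E)) := by
  have hHm : Measurable H := H.continuous_of_finiteDimensional.measurable
  have hR : MeasurableSet (LinearMap.range H : Set F) :=
    (LinearMap.range H).closed_of_finiteDimensional.measurableSet
  ext r
  constructor
  · rintro ⟨⟨μ, hμ⟩, rfl⟩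
    -- A linear section of `H`, extended to all of `F`, is continuous and hence measurable.
    obtain ⟨G₀, hG₀⟩ := H.rangeRestrict.exists_rightInverse_of_surjective H.range_rangeRestrict
    obtain ⟨G, hG⟩ := G₀.exists_extend
    have hHG : ∀ w ∈ LinearMap.range H, H (G w) = w := by
      intro w hw
      have h1 := congrArg Subtype.val (LinearMap.congr_fun hG₀ ⟨w, hw⟩)
      have h2 := LinearMap.congr_fun hG ⟨w, hw⟩
      simp only [LinearMap.comp_apply, Submodule.subtype_apply] at h1 h2
      rw [h2]
      exact h1
    have hGm : Measurable G := G.continuous_of_finiteDimensional.measurable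
    have hae : ∀ᵐ w ∂(μ : Measure F), w ∈ (LinearMap.range H : Set F) :=
      (prob_compl_eq_zero_iff hR).2 hμ
    refine ⟨μ.map hGm.aemeasurable, ?_⟩
    simp only [ProbabilityMeasure.toMeasure_map]
    rw [integral_map (f := fun g => c (H g)) hGm.aemeasurable
        (hc.comp hHm).aestronglyMeasurable,
      Measure.restrict_eq_self_of_ae_mem hae]
    exact integral_congr_ae (hae.mono fun w hw => congrArg c (hHG w hw))
  · rintro ⟨ν, rfl⟩
    have hμ : (ν.map hHm.aemeasurable : Measure F) (LinearMap.range H) = 1 := by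
      rw [ProbabilityMeasure.toMeasure_map, Measure.map_apply hHm hR]
      have : H ⁻¹' (LinearMap.range H : Set F) = Set.univ :=
        Set.eq_univ_of_forall fun g => LinearMap.mem_range_self H g
      rw [this, measure_univ]
    refine ⟨⟨ν.map hHm.aemeasurable, hμ⟩, ?_⟩
    have hae : ∀ᵐ w ∂(ν.map hHm.aemeasurable : Measure F), w ∈ (LinearMap.range H : Set F) :=
      (prob_compl_eq_zero_iff hR).2 hμ
    simp only
    rw [Measure.restrict_eq_self_of_ae_mem hae, ProbabilityMeasure.toMeasure_map,
      integral_map hHm.aemeasurable hc.aestronglyMeasurable]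

end

theorem mainTheorem6 {nx nu ny : ℕ} (S : LTISystem nx nu ny) (hS : S.IsControllable)
    (L N : ℕ) (wd : ExtTraj nu ny N) (hwd : wd ∈ S.behavior N)
    (nbar : ℕ) (hnbar : S.mcMillanDegree ≤ nbar)
    (hpe : IsPersistentlyExciting (L + nbar) wd.input)
    (c : ExtTraj nu ny L → ℝ) (hc : Measurable c) (hcb : ∃ M : ℝ, ∀ w, |c w| ≤ M) :
    (⨅ μ : S.behavioralMeasures L,
        ∫ w in S.behavior L, c w ∂((μ : ProbabilityMeasure (ExtTraj nu ny L)) :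
          Measure (ExtTraj nu ny L)) : ℝ) =
      (⨅ ν : ProbabilityMeasure (Fin (N + 1 - L) → ℝ),
        ∫ g, c (hankelMap L wd g) ∂(ν : Measure (Fin (N + 1 - L) → ℝ)) : ℝ) := by
  have hB : S.behavior L = (LinearMap.range (hankelLinearMap L wd) : Set (ExtTraj nu ny L)) := by
    rw [range_hankelLinearMap S hS hwd hnbar hpe]
    rfl
  have h := range_integral_range_eq (hankelLinearMap L wd) c hc
  rw [LTISystem.behavioralMeasures, hB]
  -- Each `⨅` is `sInf` of a range, so equality of the value sets suffices.
  exact congrArg sInf h
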